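/- Let $a,b,c\in\mathbb{Z}$ be such that $F(x)=x^4+ax^3+bx+c$ is irreducible, and let $K=\mathbb{Q}(\alpha)$, where $\alpha$ is a root of $F$, with ring of integers $\mathcal{O}_K$. For $\theta\in\mathcal{O}_K$ let $\mathrm{ind}(\theta)$ be the index of $\mathbb{Z}[\theta]$ in $\mathcal{O}_K$, and let $i(K)=\gcd\{\mathrm{ind}(\theta):\theta\in\mathcal{O}_K,\ K=\mathbb{Q}(\theta)\}$. A common index divisor of $K$ is a prime divisor of $i(K)$, and $K$ is monogenic if $\mathcal{O}_K=\mathbb{Z}[\theta]$ for some $\theta\in\mathcal{O}_K$. Let $\nu_3$ be the $3$-adic valuation, with $\nu_3(0)=\infty$, and put $m_3=m/3^{\nu_3(m)}$ for an integer $m\neq 0$. Let $$\mu=\nu_3(1-a-b+c),\quad \nu=\nu_3(-4+3a+b),\quad \omega=\nu_3(1+a+b+c),\quad \tau=\nu_3(4+3a+b).$$ Suppose that one of the following conditions holds. 1. $a\equiv\pm1\pmod 3$, $b\equiv c\equiv0\pmod 3$, $3\nu_3(b)<2\nu_3(c)$, $\nu_3(b)$ is even, and $b_3\equiv -a\pmod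 3$. 2. $(a,b)$ is congruent modulo $27$ (entry by entry) to one of $(0,4)$, $(3,22)$, $(6,13)$, $(9,4)$, $(12,22)$, $(15,13)$, $(18,4)$, $(21,22)$, $(24,13)$; $a+b\equiv1+c\pmod{243}$; and either (i) $2\nu<\mu+1$, or (ii) $2\nu>\mu+1$, $\mu$ is odd and $(1-a-b+c)_3\equiv1\pmod 3$. 3. $(a,b)$ is congruent modulo $243$ to one of $(0,23)$, $(3,14)$, $(6,5)$, $(9,23)$, $(12,14)$, $(15,5)$, $(18,23)$, $(21,14)$, $(24,5)$; $a+b\equiv-(1+c)\pmod{243}$; and either (i) $2\tau<\omega+1$, or (ii) $2\tau>\omega+1$, $\omega$ is odd and $(1+a+b+c)_3\equiv1\pmod 3$. 4. $(a,b)$ is congruent modulo $27$ to one of $(2,16)$, $(5,7)$, $(8,25)$, $(11,16)$, $(14,7)$, $(17,25)$, $(20,16)$, $(23,7)$, $(26,25)$; and $a+b\equiv c+1\pmod{81}$. Then $3\mathcal{O}_K$ is a product of four distinct prime ideals of residue degree $1$. Moreover, $3$ is a common index divisor of $K$, $\nu_3(i(K))=1$, and $K$ is not monogenic. -/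

import Mathlib

open Polynomial NumberField IntermediateField

noncomputable section

/-- The quadrinomial `x ^ 4 + a x ^ 3 + b x + c` with integer coefficients. -/
def quadrinomial (a b c : ℤ) : ℤ[X] := X ^ 4 + C a * X ^ 3 + C b * X + C c

/-- The `p`-adic valuation `ν_p(m)` of an integer, with the convention `ν_p(0) = ⊤`. -/
def nuVal (p : ℕ) (m : ℤ) : ℕ∞ := emultiplicity (p : ℤ) m

/-- `m_p = m / p ^ ν_p(m)` (the division is exact; the value at `m = 0` is `0`). -/
def pFree (p : ℕ) (m : ℤ) : ℤ := m / (p : ℤ) ^ (nuVal p m).toNat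

/-- `(a, b)` is congruent modulo `n`, entry by entry, to one of the pairs in the list `L`. -/
def PairMod (n a b : ℤ) (L : List (ℤ × ℤ)) : Prop :=
  ∃ r ∈ L, a ≡ r.1 [ZMOD n] ∧ b ≡ r.2 [ZMOD n]

/-- `ind(θ)`, the index of the additive group of `ℤ[θ]` in that of the ring of integers
(it is `0` if this index is infinite, which does not happen when `K = ℚ(θ)`). -/
def elementIndex {K : Type*} [Field K] (θ : 𝓞 K) : ℕ :=
  (Algebra.adjoin ℤ {θ}).toSubring.toAddSubgroup.index

/-- The index `i(K)`: the gcd of `ind(θ)` over all integral `θ` with `K = ℚ(θ)`. -/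
def fieldIndex (K : Type*) [Field K] [NumberField K] : ℕ :=
  Nat.setGcd {n : ℕ | ∃ θ : 𝓞 K, ℚ⟮(θ : K)⟯ = ⊤ ∧ n = elementIndex θ}

/-- A common index divisor of `K` is a prime divisor of `i(K)`. -/
def IsCommonIndexDivisor (K : Type*) [Field K] [NumberField K] (p : ℕ) : Prop :=
  p.Prime ∧ p ∣ fieldIndex K

/-- `K` is monogenic if its ring of integers is `ℤ[θ]` for some `θ`. -/
def IsMonogenicField (K : Type*) [Field K] : Prop :=
  ∃ θ : 𝓞 K, Algebra.adjoin ℤ {θ} = ⊤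

/-- `p` generates a product of four distinct prime ideals of residue degree `1`. -/
def SplitsIntoFour (K : Type*) [Field K] (p : ℕ) : Prop :=
  ∃ P : Fin 4 → Ideal (𝓞 K), Function.Injective P ∧
    (∀ i, (P i).IsPrime ∧ (P i).inertiaDeg ℤ = 1) ∧
    Ideal.span {(p : 𝓞 K)} = ∏ i, P i

end

/-! The whole theorem follows once $F$ has four distinct roots in $\mathbb{Z}_3$. Each root gives an
embedding $K\to\mathbb{Q}_3$, hence a ring map $\psi_i:\mathcal{O}_K\to\mathbb{Z}_3$. The kernel
$P_i$ of $\psi_i$ modulo 3 is a prime of norm 3 that determines $\psi_i$, so the four $P_i$ are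
distinct, and comparing norms gives $3\mathcal{O}_K=\prod P_i$
(`PadicInt.span_eq_prod_ker_residueHom`).

Four maps to $\mathbb{F}_3$ cannot take distinct values on any $\theta$, so 3 divides every index
(`dvd_index_adjoin_of_injective`), which excludes monogenicity. Conversely, the Chinese remainder
theorem gives $\theta$ with images 0, 1, 2, 3 modulo 9; its Vandermonde determinant is 12 modulo 9,
so 9 does not divide its index (`exists_not_nine_dvd_elementIndex`).

The roots come from Newton polygons: shift by $s\in\{0,\pm1\}$, rescale along each side, and lift
simple roots of the residual polynomial by Hensel's lemma. -/

/-! ### Ring homomorphisms to the p-adic integers and their residue primes. -/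

section PadicHoms

variable {R : Type*} [CommRing R] {p : ℕ} [Fact p.Prime]

/-- The reduction modulo `p` of a ring homomorphism to the `p`-adic integers. -/
noncomputable def PadicInt.residueHom (ψ : R →+* ℤ_[p]) : R →+* ZMod p :=
  PadicInt.toZMod.comp ψ

theorem PadicInt.toZMod_eq_zero_iff_dvd (x : ℤ_[p]) : PadicInt.toZMod x = 0 ↔ (p : ℤ_[p]) ∣ x := by
  rw [← RingHom.mem_ker, PadicInt.ker_toZMod, PadicInt.maximalIdeal_eq_span_p,
    Ideal.mem_span_singleton]

theorem PadicInt.mem_ker_residueHom (ψ : R →+* ℤ_[p]) (x : R) :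
    x ∈ RingHom.ker (PadicInt.residueHom ψ) ↔ (p : ℤ_[p]) ∣ ψ x := by
  rw [RingHom.mem_ker, ← PadicInt.toZMod_eq_zero_iff_dvd]; rfl

instance PadicInt.ker_residueHom_isMaximal (ψ : R →+* ℤ_[p]) :
    (RingHom.ker (PadicInt.residueHom ψ)).IsMaximal :=
  RingHom.ker_isMaximal_of_surjective _ (ZMod.ringHom_surjective _)

/-- The kernel $P$ is unramified: $\psi(P^2)\subseteq p^2\mathbb{Z}_p$ while $\psi(p)=p$, so
$p\notin P^2$. Writing $(p)=PJ$, any $u\in J\setminus P$ works. -/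
theorem PadicInt.exists_eq_mul_of_mem_ker_residueHom [IsDedekindDomain R] (ψ : R →+* ℤ_[p]) :
    ∃ u : R, ¬ (p : ℤ_[p]) ∣ ψ u ∧
      ∀ x, (p : ℤ_[p]) ∣ ψ x → ∃ y, u * x = p * y := by
  set P := RingHom.ker (PadicInt.residueHom ψ) with hP
  have hle : Ideal.span {(p : R)} ≤ P := by
    rw [Ideal.span_singleton_le_iff_mem, PadicInt.mem_ker_residueHom, map_natCast]
  obtain ⟨J, hJ⟩ := Ideal.dvd_iff_le.mpr hle
  have hJP : ¬ J ≤ P := by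
    intro h
    have h1 : Ideal.span {(p : R)} ≤ P ^ 2 := by
      rw [hJ, pow_two]; exact Ideal.mul_mono_right h
    have h2 : P ^ 2 ≤ (Ideal.span {(p : ℤ_[p]) ^ 2}).comap ψ := by
      rw [pow_two, Ideal.mul_le]
      intro r hr s hs
      rw [Ideal.mem_comap, Ideal.mem_span_singleton, map_mul, pow_two]
      exact mul_dvd_mul ((PadicInt.mem_ker_residueHom ψ r).1 hr)
        ((PadicInt.mem_ker_residueHom ψ s).1 hs)
    have h3 := h2 (h1 (Ideal.mem_span_singleton_self _))
    rw [Ideal.mem_comap, Ideal.mem_span_singleton, map_natCast, pow_two] at h3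
    have h4 : (p : ℤ_[p]) * p ∣ p * 1 := by simpa using h3
    exact PadicInt.prime_p.not_isUnit
      (isUnit_of_dvd_one ((mul_dvd_mul_iff_left PadicInt.prime_p.ne_zero).1 h4))
  obtain ⟨u, huJ, huP⟩ := Set.not_subset.1 hJP
  refine ⟨u, fun h => huP ((PadicInt.mem_ker_residueHom ψ u).2 h), fun x hx => ?_⟩
  have : x * u ∈ Ideal.span {(p : R)} := by
    rw [hJ]; exact Ideal.mul_mem_mul ((PadicInt.mem_ker_residueHom ψ x).2 hx) huJ
  rwa [Ideal.mem_span_singleton, mul_comm] at this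

/-- Successive approximation: subtracting an integer puts $x$ in the common kernel, where $ux=py$
with $\psi_1(u)$ a unit, so agreement modulo $p^n$ on all of $R$ improves to $p^{n+1}$. -/
theorem PadicInt.ringHom_eq_of_ker_residueHom_eq [IsDedekindDomain R] {ψ₁ ψ₂ : R →+* ℤ_[p]}
    (h : RingHom.ker (PadicInt.residueHom ψ₁) = RingHom.ker (PadicInt.residueHom ψ₂)) :
    ψ₁ = ψ₂ := by
  obtain ⟨u, hu, hup⟩ := PadicInt.exists_eq_mul_of_mem_ker_residueHom ψ₁
  have hint : ∀ x : R, ∃ k : ℕ, (p : ℤ_[p]) ∣ ψ₁ (x - k) ∧ (p : ℤ_[p]) ∣ ψ₂ (x - k) := by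
    intro x
    have : x - ((PadicInt.residueHom ψ₁ x).val : R) ∈ RingHom.ker (PadicInt.residueHom ψ₁) := by
      rw [RingHom.mem_ker, map_sub, map_natCast, ZMod.natCast_zmod_val, sub_self]
    exact ⟨_, (PadicInt.mem_ker_residueHom ψ₁ _).1 this,
      (PadicInt.mem_ker_residueHom ψ₂ _).1 (h ▸ this)⟩
  have key : ∀ n x, (p : ℤ_[p]) ^ n ∣ ψ₁ x - ψ₂ x := by
    intro n
    induction n with
    | zero => simp
    | succ n ih =>
      intro x
      obtain ⟨k, hk1, hk2⟩ := hint x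
      obtain ⟨y, hy⟩ := hup _ hk1
      have e1 : ψ₁ u * ψ₁ (x - k) = p * ψ₁ y := by
        rw [← map_mul, hy, map_mul, map_natCast]
      have e2 : ψ₂ u * ψ₂ (x - k) = p * ψ₂ y := by
        rw [← map_mul, hy, map_mul, map_natCast]
      have e3 : ψ₁ u * (ψ₁ x - ψ₂ x) =
          p * (ψ₁ y - ψ₂ y) - (ψ₁ u - ψ₂ u) * ψ₂ (x - k) := by
        have : ψ₁ x - ψ₂ x = ψ₁ (x - k) - ψ₂ (x - k) := by
          simp only [map_sub, map_natCast]; ring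
        rw [this]; linear_combination e1 - e2
      have e4 : (p : ℤ_[p]) ^ (n + 1) ∣ ψ₁ u * (ψ₁ x - ψ₂ x) := by
        rw [e3]
        refine dvd_sub ?_ ?_
        · rw [pow_succ']; exact mul_dvd_mul_left _ (ih y)
        · rw [pow_succ]; exact mul_dvd_mul (ih u) hk2
      exact PadicInt.prime_p.pow_dvd_of_dvd_mul_left _ hu e4
  ext x : 1
  refine PadicInt.ext_of_toZModPow.1 fun n => ?_
  rw [← sub_eq_zero, ← map_sub, ← RingHom.mem_ker, PadicInt.ker_toZModPow,
    Ideal.mem_span_singleton]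
  exact key n x

theorem PadicInt.absNorm_ker_residueHom [IsDedekindDomain R] [Module.Free ℤ R]
    [Module.Finite ℤ R] (ψ : R →+* ℤ_[p]) :
    Ideal.absNorm (RingHom.ker (PadicInt.residueHom ψ)) = p := by
  rw [Ideal.absNorm_apply, Submodule.cardQuot_apply]
  rw [Nat.card_congr (RingHom.quotientKerEquivOfSurjective
    (ZMod.ringHom_surjective (PadicInt.residueHom ψ))).toEquiv, Nat.card_zmod]

theorem PadicInt.inertiaDeg_ker_residueHom [IsDedekindDomain R] [Module.Free ℤ R]
    [Module.Finite ℤ R] (ψ : R →+* ℤ_[p]) :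
    (RingHom.ker (PadicInt.residueHom ψ)).inertiaDeg ℤ = 1 := by
  have hp : p.Prime := Fact.out
  have hover : (RingHom.ker (PadicInt.residueHom ψ)).LiesOver (Ideal.span {(p : ℤ)}) := by
    refine ⟨?_⟩
    have hmax : (Ideal.span {(p : ℤ)}).IsMaximal :=
      PrincipalIdealRing.isMaximal_of_irreducible (Nat.prime_iff_prime_int.1 hp).irreducible
    refine hmax.eq_of_le (Ideal.IsPrime.ne_top inferInstance) ?_
    rw [Ideal.span_singleton_le_iff_mem, Ideal.mem_comap, PadicInt.mem_ker_residueHom]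
    simp
  have h := Ideal.pow_inertiaDeg p (RingHom.ker (PadicInt.residueHom ψ))
  rw [PadicInt.absNorm_ker_residueHom] at h
  exact Nat.pow_right_injective hp.two_le (by simpa using h)

theorem PadicInt.isCoprime_ker_residueHom [IsDedekindDomain R] {ι : Type*} {ψ : ι → R →+* ℤ_[p]}
    (hψ : Function.Injective ψ) :
    Pairwise (Function.onFun IsCoprime fun i => RingHom.ker (PadicInt.residueHom (ψ i))) := by
  intro i j hij
  refine Ideal.isCoprime_iff_sup_eq.2 (Ideal.IsMaximal.coprime_of_ne inferInstance inferInstance ?_)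
  exact fun h => hij (hψ (PadicInt.ringHom_eq_of_ker_residueHom_eq h))

/-- The product of these coprime primes divides $(p)$, and both have norm $p^{\mathrm{rank}}$, so
the cofactor is trivial. -/
theorem PadicInt.span_eq_prod_ker_residueHom [IsDedekindDomain R] [Module.Free ℤ R]
    [Module.Finite ℤ R] {ι : Type*} [Fintype ι] {ψ : ι → R →+* ℤ_[p]}
    (hψ : Function.Injective ψ) (hcard : Fintype.card ι = Module.finrank ℤ R) :
    Ideal.span {(p : R)} = ∏ i, RingHom.ker (PadicInt.residueHom (ψ i)) := by
  have hp : p.Prime := Fact.out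
  obtain ⟨J, hJ⟩ : ∏ i, RingHom.ker (PadicInt.residueHom (ψ i)) ∣ Ideal.span {(p : R)} := by
    refine Finset.prod_dvd_of_coprime
      (fun i _ j _ hij => PadicInt.isCoprime_ker_residueHom hψ hij) fun i _ => ?_
    rw [Ideal.dvd_iff_le, Ideal.span_singleton_le_iff_mem, PadicInt.mem_ker_residueHom,
      map_natCast]
  have hnorm : Ideal.absNorm (Ideal.span {(p : R)}) = p ^ Fintype.card ι := by
    rw [Ideal.absNorm_span_singleton, hcard]
    have := Algebra.norm_algebraMap (R := ℤ) (S := R) (p : ℤ)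
    rw [map_natCast] at this
    rw [this, Int.natAbs_pow, Int.natAbs_natCast]
  rw [hJ, map_mul, map_prod] at hnorm
  simp only [PadicInt.absNorm_ker_residueHom, Finset.prod_const, Finset.card_univ] at hnorm
  have hJ1 : Ideal.absNorm J = 1 :=
    Nat.eq_of_mul_eq_mul_left (pow_pos hp.pos _) (hnorm.trans (mul_one _).symm)
  rw [hJ, Ideal.absNorm_eq_one_iff.1 hJ1, Ideal.mul_top]

theorem PadicInt.exists_forall_toZModPow_eq [IsDedekindDomain R] {ι : Type*} [Fintype ι]
    {ψ : ι → R →+* ℤ_[p]} (hψ : Function.Injective ψ) (n : ℕ) (t : ι → ℕ) :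
    ∃ θ : R, ∀ i, PadicInt.toZModPow n (ψ i θ) = (t i : ZMod (p ^ n)) := by
  obtain ⟨θ, hθ⟩ := Ideal.exists_forall_sub_mem_ideal
    (I := fun i => RingHom.ker (PadicInt.residueHom (ψ i)) ^ n)
    (fun i j hij => IsCoprime.pow (PadicInt.isCoprime_ker_residueHom hψ hij))
    (fun i => (t i : R))
  refine ⟨θ, fun i => ?_⟩
  have hle : RingHom.ker (PadicInt.residueHom (ψ i)) ^ n ≤
      (Ideal.span {(p : ℤ_[p]) ^ n}).comap (ψ i) := by
    rw [← Ideal.span_singleton_pow]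
    refine le_trans (Ideal.pow_right_mono ?_ n) (Ideal.le_comap_pow _ n)
    intro x hx
    rw [Ideal.mem_comap, Ideal.mem_span_singleton]
    exact (PadicInt.mem_ker_residueHom _ _).1 hx
  have := hle (hθ i)
  rw [Ideal.mem_comap, ← PadicInt.ker_toZModPow, RingHom.mem_ker, map_sub, map_sub, map_natCast,
    map_natCast, sub_eq_zero] at this
  exact this

end PadicHoms

/-! ### Bounding the index of ℤ[θ] from both sides. -/

theorem RingHom.eq_of_apply_eq_of_not_dvd_index {R S : Type*} [CommRing R] [CommRing S]
    [IsDomain S] {f g : R →+* S} {θ : R} (h : f θ = g θ)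
    (hS : ((Algebra.adjoin ℤ {θ}).toSubring.toAddSubgroup.index : S) ≠ 0) : f = g := by
  have hadj : ∀ x ∈ Algebra.adjoin ℤ {θ}, f x = g x := by
    intro x hx
    have := AlgHom.eqOn_adjoin_iff (φ := f.toIntAlgHom) (ψ := g.toIntAlgHom) (s := {θ})
    exact this.2 (by simpa using h) hx
  ext x
  -- The index times any `x` lies in ℤ[θ], where the two maps agree.
  have h1 := hadj _ (AddSubgroup.nsmul_index_mem
    (Algebra.adjoin ℤ {θ}).toSubring.toAddSubgroup x)
  rw [nsmul_eq_mul, map_mul, map_mul, map_natCast, map_natCast] at h1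
  exact mul_left_cancel₀ hS h1

theorem dvd_index_adjoin_of_injective {R : Type*} [CommRing R] {p : ℕ} [Fact p.Prime] {ι : Type*}
    [Fintype ι] (hcard : p < Fintype.card ι) {f : ι → R →+* ZMod p} (hf : Function.Injective f)
    (θ : R) : p ∣ (Algebra.adjoin ℤ {θ}).toSubring.toAddSubgroup.index := by
  by_contra hdvd
  obtain ⟨i, j, hij, h⟩ := Fintype.exists_ne_map_eq_of_card_lt (fun i => f i θ)
    (by rwa [ZMod.card])
  exact hij (hf (RingHom.eq_of_apply_eq_of_not_dvd_index h
    (by rwa [Ne, ZMod.natCast_eq_zero_iff])))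

/-- The lattice spanned by $1,\dots,\theta^{n-1}$ lies in ℤ[θ] and has index $|\det|$ when the
determinant is nonzero. -/
theorem index_adjoin_dvd_natAbs_det {R : Type*} [CommRing R] {n : ℕ}
    (b : Module.Basis (Fin n) ℤ R) (θ : R) :
    (Algebra.adjoin ℤ {θ}).toSubring.toAddSubgroup.index ∣
      (b.det fun j : Fin n => θ ^ (j : ℕ)).natAbs := by
  by_cases h0 : (b.det fun j : Fin n => θ ^ (j : ℕ)) = 0
  · simp [h0]
  set v : Fin n → R := fun j => θ ^ (j : ℕ)
  have : Module.Free ℤ R := Module.Free.of_basis b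
  have : Module.Finite ℤ R := Module.Finite.of_basis b
  let f : R →ₗ[ℤ] R := b.constr ℤ v
  have hdet : LinearMap.det f = b.det v := by
    rw [← LinearMap.det_toMatrix b, Module.Basis.det_apply]
    congr 1
    ext i j
    simp [f, LinearMap.toMatrix_apply, Module.Basis.toMatrix_apply]
  have hinj : Function.Injective f := by
    rw [← LinearMap.ker_eq_bot]
    by_contra hk
    exact h0 (hdet ▸ LinearMap.det_eq_zero_iff_ker_ne_bot.2 hk)
  have hcard := Submodule.natAbs_det_equiv (LinearMap.range f) (LinearEquiv.ofInjective f hinj)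
  have hcomp : (LinearMap.range f).subtype ∘ₗ AddMonoidHom.toIntLinearMap
      ((LinearEquiv.ofInjective f hinj : R ≃ₗ[ℤ] LinearMap.range f) :
        R →+ LinearMap.range f) = f := by
    ext x; rfl
  rw [hcomp, hdet] at hcard
  rw [hcard]
  refine AddSubgroup.index_dvd_of_le (H := (LinearMap.range f).toAddSubgroup) ?_
  intro x hx
  have hx' : x ∈ LinearMap.range f := hx
  rw [Module.Basis.constr_range] at hx'
  have hle : Submodule.span ℤ (Set.range v) ≤ Subalgebra.toSubmodule (Algebra.adjoin ℤ {θ}) := by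
    rw [Submodule.span_le]
    rintro _ ⟨j, rfl⟩
    exact pow_mem (Algebra.self_mem_adjoin_singleton ℤ θ) _
  exact hle hx'

theorem det_vandermonde_eq_mul_det {R S : Type*} [CommRing R] [CommRing S] {n : ℕ}
    (b : Module.Basis (Fin n) ℤ R) (f : Fin n → R →+* S) (θ : R) :
    (Matrix.vandermonde fun i => f i θ).det =
      (Matrix.of fun i j => f i (b j)).det * ((b.det fun j : Fin n => θ ^ (j : ℕ) : ℤ) : S) := by
  have : Matrix.vandermonde (fun i => f i θ) = (Matrix.of fun i j => f i (b j)) *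
      (b.toMatrix fun j : Fin n => θ ^ (j : ℕ)).map (Int.castRingHom S) := by
    ext i j
    rw [Matrix.vandermonde_apply, Matrix.mul_apply, ← map_pow]
    conv_lhs => rw [← b.sum_repr (θ ^ (j : ℕ)), map_sum]
    refine Finset.sum_congr rfl fun k _ => ?_
    simp [Module.Basis.toMatrix_apply, mul_comm]
  rw [this, Matrix.det_mul, Module.Basis.det_apply]
  congr 1
  exact (RingHom.map_det (Int.castRingHom S) _).symm

/-! ### From p-adic roots to embeddings of the number field. -/

section NumberField

variable {K : Type*} [Field K] {p : ℕ} [Fact p.Prime]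

theorem PadicInt.mem_range_of_isIntegral_int {x : ℚ_[p]} (hx : IsIntegral ℤ x) :
    x ∈ (algebraMap ℤ_[p] ℚ_[p]).range :=
  IsIntegrallyClosed.isIntegral_iff.1 (IsIntegral.tower_top (A := ℤ_[p]) hx)

theorem NumberField.exists_ringOfIntegers_hom (φ : K →+* ℚ_[p]) :
    ∃ ψ : 𝓞 K →+* ℤ_[p], ∀ x : 𝓞 K, (ψ x : ℚ_[p]) = φ x := by
  have hmem : ∀ x : 𝓞 K, (φ.comp (algebraMap (𝓞 K) K)) x ∈ (algebraMap ℤ_[p] ℚ_[p]).range :=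
    fun x => PadicInt.mem_range_of_isIntegral_int
      ((RingOfIntegers.isIntegral_coe x).map φ.toIntAlgHom)
  let e := RingEquiv.ofBijective (algebraMap ℤ_[p] ℚ_[p]).rangeRestrict
    ⟨fun x y h => by
        have h' := Subtype.ext_iff.1 h
        exact IsFractionRing.injective ℤ_[p] ℚ_[p] h',
      (algebraMap ℤ_[p] ℚ_[p]).rangeRestrict_surjective⟩
  refine ⟨(e.symm : _ →+* ℤ_[p]).comp ((φ.comp (algebraMap (𝓞 K) K)).codRestrict _ hmem),
    fun x => ?_⟩
  have := e.apply_symm_apply ((φ.comp (algebraMap (𝓞 K) K)).codRestrict _ hmem x)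
  exact congrArg Subtype.val this

variable [NumberField K]

theorem NumberField.exists_injective_ringOfIntegers_hom {ι : Type*} {f : ℤ[X]} (hf : f.Monic)
    (hirr : Irreducible f) {α : K} (hroot : aeval α f = 0) (hgen : ℚ⟮α⟯ = ⊤) {r : ι → ℤ_[p]}
    (hr : Function.Injective r) (hroots : ∀ i, aeval (r i) f = 0) :
    Module.finrank ℚ K = f.natDegree ∧
      ∃ ψ : ι → 𝓞 K →+* ℤ_[p], Function.Injective ψ := by
  have hmin : f.map (algebraMap ℤ ℚ) = minpoly ℚ α :=
    minpoly.eq_of_irreducible_of_monic (hf.irreducible_iff_irreducible_map_fraction_map.1 hirr)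
      (by rw [aeval_map_algebraMap]; exact hroot) (hf.map _)
  have hint : IsIntegral ℚ α := IsIntegral.of_finite ℚ α
  refine ⟨?_, ?_⟩
  · rw [← (Field.primitive_element_iff_minpoly_natDegree_eq ℚ α).1 hgen, ← hmin,
      hf.natDegree_map]
  let pb := (adjoin.powerBasis hint).map ((IntermediateField.equivOfEq hgen).trans
    IntermediateField.topEquiv)
  have hpb : pb.gen = α := by
    simp [pb]
  have hφ : ∀ i, ∃ φ : K →+* ℚ_[p], φ α = r i := by
    intro i
    refine ⟨(pb.lift (r i : ℚ_[p]) ?_).toRingHom, ?_⟩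
    · rw [hpb, ← hmin, aeval_map_algebraMap]
      have := congrArg (algebraMap ℤ_[p] ℚ_[p]) (hroots i)
      rw [← aeval_algebraMap_apply, map_zero] at this
      exact this
    · have := pb.lift_gen (r i : ℚ_[p]) ?_
      · rw [hpb] at this; exact this
  choose φ hφ using hφ
  choose ψ hψ using fun i => NumberField.exists_ringOfIntegers_hom (φ i)
  refine ⟨ψ, fun i j hij => hr ?_⟩
  have : φ i = φ j := by
    refine IsFractionRing.ringHom_ext (A := 𝓞 K) fun x => ?_
    have h1 := hψ i x
    rw [hij, hψ j x] at h1
    exact h1.symm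
  have h2 := hφ i
  rw [this, hφ j] at h2
  exact Subtype.ext h2.symm

/-- The values $\psi_i(\theta)$ are distinct roots of the minimal polynomial of $\theta$, which
forces its degree up to $[K:\mathbb{Q}]$. -/
theorem NumberField.adjoin_eq_top_of_injective {ι : Type*} [Fintype ι] {ψ : ι → 𝓞 K →+* ℤ_[p]}
    {θ : 𝓞 K} (hθ : Function.Injective fun i => ψ i θ)
    (hcard : Fintype.card ι = Module.finrank ℚ K) : ℚ⟮(θ : K)⟯ = ⊤ := by
  classical
  have hint : IsIntegral ℤ θ := RingOfIntegers.isIntegral θ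
  rw [Field.primitive_element_iff_minpoly_natDegree_eq]
  refine le_antisymm (minpoly.natDegree_le _) ?_
  have hmin : minpoly ℚ (θ : K) = (minpoly ℤ θ).map (algebraMap ℤ ℚ) := by
    rw [minpoly.isIntegrallyClosed_eq_field_fractions' ℚ (RingOfIntegers.isIntegral_coe θ),
      RingOfIntegers.minpoly_coe]
  rw [hmin, (minpoly.monic hint).natDegree_map, ← hcard, ← Finset.card_univ,
    ← Finset.card_image_of_injective _ hθ]
  set g := (minpoly ℤ θ).map (algebraMap ℤ ℤ_[p]) with hg
  have hgm : g.Monic := (minpoly.monic hint).map _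
  calc (Finset.univ.image fun i => ψ i θ).card ≤ g.roots.toFinset.card := by
        refine Finset.card_le_card fun x hx => ?_
        obtain ⟨i, -, rfl⟩ := Finset.mem_image.1 hx
        rw [Multiset.mem_toFinset, mem_roots hgm.ne_zero, IsRoot.def, hg, eval_map_algebraMap]
        have := aeval_algHom_apply (ψ i).toIntAlgHom θ (minpoly ℤ θ)
        rw [minpoly.aeval, map_zero] at this
        exact this
    _ ≤ g.roots.card := Multiset.toFinset_card_le _
    _ ≤ g.natDegree := card_roots' _
    _ = _ := (minpoly.monic hint).natDegree_map _

end NumberField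

/-! ### Splitting and index from four homomorphisms. -/

theorem splitsIntoFour_of_injective {K : Type*} [Field K] [NumberField K] {p : ℕ} [Fact p.Prime]
    (hK : Module.finrank ℚ K = 4) {ψ : Fin 4 → 𝓞 K →+* ℤ_[p]} (hψ : Function.Injective ψ) :
    SplitsIntoFour K p := by
  refine ⟨fun i => RingHom.ker (PadicInt.residueHom (ψ i)), fun i j hij => ?_, fun i => ⟨?_, ?_⟩, ?_⟩
  · exact hψ (PadicInt.ringHom_eq_of_ker_residueHom_eq hij)
  · exact (PadicInt.ker_residueHom_isMaximal (ψ i)).isPrime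
  · exact PadicInt.inertiaDeg_ker_residueHom (ψ i)
  · exact PadicInt.span_eq_prod_ker_residueHom hψ (by rw [RingOfIntegers.rank, hK, Fintype.card_fin])

theorem three_dvd_elementIndex {K : Type*} [Field K] [NumberField K]
    {ψ : Fin 4 → 𝓞 K →+* ℤ_[3]} (hψ : Function.Injective ψ) (θ : 𝓞 K) :
    3 ∣ elementIndex θ := by
  refine dvd_index_adjoin_of_injective (f := fun i => PadicInt.residueHom (ψ i)) (by simp) ?_ θ
  intro i j hij
  exact hψ (PadicInt.ringHom_eq_of_ker_residueHom_eq (congrArg RingHom.ker hij))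

theorem exists_not_nine_dvd_elementIndex {K : Type*} [Field K] [NumberField K]
    (hK : Module.finrank ℚ K = 4) {ψ : Fin 4 → 𝓞 K →+* ℤ_[3]} (hψ : Function.Injective ψ) :
    ∃ θ : 𝓞 K, ℚ⟮(θ : K)⟯ = ⊤ ∧ ¬ 9 ∣ elementIndex θ := by
  -- Among 0, 1, 2, 3 only the difference 3 − 0 is divisible by 3, and it is nonzero modulo 9.
  obtain ⟨θ, hθ⟩ := PadicInt.exists_forall_toZModPow_eq hψ 2 (fun i : Fin 4 => (i : ℕ))
  refine ⟨θ, NumberField.adjoin_eq_top_of_injective (ψ := ψ) (fun i j hij => ?_) (by simp [hK]), ?_⟩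
  · have h1 := congrArg (PadicInt.toZModPow 2) hij
    simp only [hθ] at h1
    have hinj : ∀ i j : Fin 4, ((i : ℕ) : ZMod 9) = ((j : ℕ) : ZMod 9) → i = j := by decide
    exact hinj i j h1
  · intro hdvd
    let b : Module.Basis (Fin 4) ℤ (𝓞 K) :=
      Module.finBasisOfFinrankEq ℤ (𝓞 K) (by rw [RingOfIntegers.rank, hK])
    have hdet := det_vandermonde_eq_mul_det b (fun i => (PadicInt.toZModPow 2).comp (ψ i)) θ
    have h9 : ((9 : ℕ) : ℤ) ∣ b.det fun j : Fin 4 => θ ^ (j : ℕ) :=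
      Int.natCast_dvd.2 (hdvd.trans (index_adjoin_dvd_natAbs_det b θ))
    have h0 : ((b.det fun j : Fin 4 => θ ^ (j : ℕ) : ℤ) : ZMod (3 ^ 2)) = 0 :=
      (ZMod.intCast_zmod_eq_zero_iff_dvd _ _).2 h9
    rw [h0, mul_zero, Matrix.det_vandermonde] at hdet
    simp only [RingHom.comp_apply, hθ] at hdet
    revert hdet
    change ¬ (∏ i : Fin 4, ∏ j ∈ Finset.Ioi i, (((j : ℕ) : ZMod 9) - ((i : ℕ) : ZMod 9)) = 0)
    decide

theorem not_isMonogenicField_of_forall_dvd {K : Type*} [Field K] [NumberField K] {p : ℕ}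
    (hp : p ≠ 1) (h : ∀ θ : 𝓞 K, p ∣ elementIndex θ) : ¬ IsMonogenicField K := by
  rintro ⟨θ, hθ⟩
  have h1 := h θ
  have h2 : elementIndex θ = 1 := by
    rw [elementIndex, AddSubgroup.index_eq_one, hθ]
    rfl
  rw [h2, Nat.dvd_one] at h1
  exact hp h1

theorem splits_three_of_roots {a b c : ℤ} {K : Type*} [Field K] [NumberField K] {α : K}
    (hirr : Irreducible (quadrinomial a b c)) (hroot : aeval α (quadrinomial a b c) = 0)
    (hgen : ℚ⟮α⟯ = ⊤) {r : Fin 4 → ℤ_[3]} (hr : Function.Injective r)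
    (hroots : ∀ i, r i ^ 4 + a * r i ^ 3 + b * r i + c = 0) :
    SplitsIntoFour K 3 ∧ IsCommonIndexDivisor K 3 ∧ emultiplicity 3 (fieldIndex K) = 1 ∧
      ¬ IsMonogenicField K := by
  have hdeg : (quadrinomial a b c).natDegree = 4 := by
    rw [quadrinomial]; compute_degree!
  have hmonic : (quadrinomial a b c).Monic := by
    rw [quadrinomial]; monicity!
  obtain ⟨hK, ψ, hψ⟩ := NumberField.exists_injective_ringOfIntegers_hom hmonic hirr hroot hgen hr
    (fun i => by simpa [quadrinomial] using hroots i)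
  rw [hdeg] at hK
  have h3 : 3 ∣ fieldIndex K := by
    refine Nat.dvd_setGcd_iff.2 ?_
    rintro _ ⟨θ, -, rfl⟩
    exact three_dvd_elementIndex hψ θ
  refine ⟨splitsIntoFour_of_injective hK hψ, ⟨Nat.prime_three, h3⟩, ?_,
    not_isMonogenicField_of_forall_dvd (by norm_num) (three_dvd_elementIndex hψ)⟩
  obtain ⟨θ, hθ, h9⟩ := exists_not_nine_dvd_elementIndex hK hψ
  have : emultiplicity 3 (fieldIndex K) = (1 : ℕ) := by
    refine emultiplicity_eq_coe.2 ⟨by simpa using h3, fun h => h9 ?_⟩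
    exact (show 9 ∣ fieldIndex K from h).trans (Nat.setGcd_dvd_of_mem ⟨θ, hθ, rfl⟩)
  simpa using this

/-! ### Hensel lifting along the sides of a Newton polygon. -/

section Roots

theorem PadicInt.exists_root_of_simple_root_mod {p : ℕ} [Fact p.Prime] (H : ℤ[X]) (z₀ : ℤ)
    (h : (p : ℤ) ∣ H.eval z₀) (hd : ¬ (p : ℤ) ∣ H.derivative.eval z₀) :
    ∃ z : ℤ_[p], PadicInt.toZMod z = (z₀ : ZMod p) ∧ aeval z H = 0 := by
  have he : ∀ G : ℤ[X], aeval (z₀ : ℤ_[p]) G = ((G.eval z₀ : ℤ) : ℤ_[p]) := fun G => by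
    simpa using aeval_algebraMap_apply (A := ℤ) ℤ_[p] z₀ G
  have h1 : ‖aeval (z₀ : ℤ_[p]) H‖ < 1 := by
    rw [he]; exact PadicInt.norm_intCast_lt_one_iff.2 h
  have h2 : ‖aeval (z₀ : ℤ_[p]) H.derivative‖ = 1 := by
    rw [he]
    exact le_antisymm (PadicInt.norm_le_one _)
      (not_lt.1 fun hlt => hd (PadicInt.norm_intCast_lt_one_iff.1 hlt))
  obtain ⟨z, hz, hz1, -⟩ := hensels_lemma (F := H) (a := (z₀ : ℤ_[p])) (by rw [h2]; simpa using h1)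
  refine ⟨z, ?_, hz⟩
  rw [h2, PadicInt.norm_lt_one_iff_dvd, ← PadicInt.toZMod_eq_zero_iff_dvd, map_sub, sub_eq_zero] at hz1
  rw [hz1, map_intCast]

theorem PadicInt.exists_root_quartic {p : ℕ} [Fact p.Prime] (a₄ a₃ a₂ a₁ a₀ z₀ : ℤ)
    (h : (a₄ * z₀ ^ 4 + a₃ * z₀ ^ 3 + a₂ * z₀ ^ 2 + a₁ * z₀ + a₀ : ZMod p) = 0)
    (hd : (4 * a₄ * z₀ ^ 3 + 3 * a₃ * z₀ ^ 2 + 2 * a₂ * z₀ + a₁ : ZMod p) ≠ 0) :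
    ∃ z : ℤ_[p], PadicInt.toZMod z = (z₀ : ZMod p) ∧
      a₄ * z ^ 4 + a₃ * z ^ 3 + a₂ * z ^ 2 + a₁ * z + a₀ = 0 := by
  obtain ⟨z, hz, hroot⟩ := PadicInt.exists_root_of_simple_root_mod (p := p)
    (C a₄ * X ^ 4 + C a₃ * X ^ 3 + C a₂ * X ^ 2 + C a₁ * X + C a₀) z₀
    (by rw [← ZMod.intCast_zmod_eq_zero_iff_dvd]; simpa using h)
    (by
      rw [← ZMod.intCast_zmod_eq_zero_iff_dvd]
      simp only [derivative_add, derivative_C_mul, derivative_X_pow, derivative_X, derivative_C]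
      simp only [eval_add, eval_mul, eval_pow, eval_C, eval_X, eval_one, eval_zero]
      push_cast
      intro h0
      apply hd
      rw [← h0]
      norm_num
      ring)
  exact ⟨z, hz, by simpa using hroot⟩

theorem injective_vec_four {M : Type*} {x y z w : M} (hxy : x ≠ y) (hxz : x ≠ z) (hxw : x ≠ w)
    (hyz : y ≠ z) (hyw : y ≠ w) (hzw : z ≠ w) : Function.Injective ![x, y, z, w] := by
  intro i j h
  fin_cases i <;> fin_cases j <;> simp_all

theorem three_eq_zero_zmod_three : (3 : ZMod 3) = 0 := by decide

theorem PadicInt.toZMod_three : PadicInt.toZMod (p := 3) 3 = 0 := by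
  rw [map_ofNat]; exact three_eq_zero_zmod_three

theorem exists_unit_root {A B D E : ℤ} (hA : (A : ZMod 3) ≠ 0) (hB : 3 ∣ B) (hD : 3 ∣ D)
    (hE : 3 ∣ E) :
    ∃ z : ℤ_[3], PadicInt.toZMod z ≠ 0 ∧ z ^ 4 + A * z ^ 3 + B * z ^ 2 + D * z + E = 0 := by
  replace hB := (ZMod.intCast_zmod_eq_zero_iff_dvd B 3).2 hB
  replace hD := (ZMod.intCast_zmod_eq_zero_iff_dvd D 3).2 hD
  replace hE := (ZMod.intCast_zmod_eq_zero_iff_dvd E 3).2 hE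
  obtain ⟨z, hz, h⟩ := PadicInt.exists_root_quartic (p := 3) 1 A B D E (-A)
    (by push_cast; rw [hB, hD, hE]; ring)
    (by push_cast; rw [hB, hD]; generalize (A : ZMod 3) = x at hA; revert x; decide)
  refine ⟨z, ?_, by simpa using h⟩
  rw [hz]; push_cast; exact neg_ne_zero.2 hA

/-- Substituting $3tz$ and dividing by $27t^3$ leaves $A(z^3-z)$ modulo 3: it vanishes on all of
$\mathbb{F}_3$ with derivative $-A\ne0$, giving three roots besides the unit one. -/
theorem exists_roots_of_one_two_side {A B D E t B' d E' : ℤ} (ht : t ≠ 0) (hA : (A : ZMod 3) ≠ 0)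
    (hB : B = 9 * t * B') (hD : D = 9 * t ^ 2 * d) (hE : E = 81 * t ^ 3 * E')
    (hd : (d : ZMod 3) = -A) :
    ∃ r : Fin 4 → ℤ_[3], Function.Injective r ∧
      ∀ i, r i ^ 4 + A * r i ^ 3 + B * r i ^ 2 + D * r i + E = 0 := by
  have h3 := three_eq_zero_zmod_three
  obtain ⟨u, hu, hur⟩ := exists_unit_root (A := A) (B := B) (D := D) (E := E) hA
    ⟨3 * t * B', by rw [hB]; ring⟩
    ⟨3 * t ^ 2 * d, by rw [hD]; ring⟩
    ⟨27 * t ^ 3 * E', by rw [hE]; ring⟩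
  have key : ∀ z₀ : ℤ, ∃ z : ℤ_[3], PadicInt.toZMod z = (z₀ : ZMod 3) ∧
      ((3 * t : ℤ) * z) ^ 4 + A * ((3 * t : ℤ) * z) ^ 3 + B * ((3 * t : ℤ) * z) ^ 2 +
        D * ((3 * t : ℤ) * z) + E = 0 := by
    intro z₀
    obtain ⟨z, hz, h⟩ := PadicInt.exists_root_quartic (p := 3) (3 * t) A (3 * B') d (3 * E') z₀
      (by
        push_cast; rw [h3, hd]
        generalize (A : ZMod 3) = x; generalize (z₀ : ZMod 3) = y
        simp only [zero_mul, zero_add, add_zero]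
        revert x y; decide)
      (by
        push_cast; rw [h3, hd]
        generalize (A : ZMod 3) = x at hA
        simpa using hA)
    refine ⟨z, hz, ?_⟩
    rw [hB, hD, hE]
    push_cast at h ⊢
    linear_combination 27 * (t : ℤ_[3]) ^ 3 * h
  obtain ⟨z₀, h0, r0⟩ := key 0
  obtain ⟨z₁, h1, r1⟩ := key 1
  obtain ⟨z₂, h2, r2⟩ := key 2
  have h3t : ((3 * t : ℤ) : ℤ_[3]) ≠ 0 := by exact_mod_cast mul_ne_zero three_ne_zero ht
  have hne : ∀ z : ℤ_[3], u ≠ (3 * t : ℤ) * z := by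
    rintro z rfl
    apply hu
    push_cast
    rw [map_mul, map_mul, PadicInt.toZMod_three]; ring
  have hne' : ∀ z w : ℤ_[3], PadicInt.toZMod z ≠ PadicInt.toZMod w →
      (3 * t : ℤ) * z ≠ (3 * t : ℤ) * w :=
    fun z w hzw h => hzw (congrArg _ (mul_left_cancel₀ h3t h))
  have h01 := hne' z₀ z₁ (by rw [h0, h1]; decide)
  have h02 := hne' z₀ z₂ (by rw [h0, h2]; decide)
  have h12 := hne' z₁ z₂ (by rw [h1, h2]; decide)
  refine ⟨![u, (3 * t : ℤ) * z₀, (3 * t : ℤ) * z₁, (3 * t : ℤ) * z₂], ?_, ?_⟩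
  · exact injective_vec_four (hne _) (hne _) (hne _) h01 h02 h12
  · intro i
    fin_cases i
    exacts [hur, r0, r1, r2]

/-- The roots live at three scales: a unit, 3 times a unit, and two of the form $9tw$. At the last
scale, dividing by $243t^2$ leaves $B'w^2+dw+e$ modulo 3. -/
theorem exists_roots_of_one_one_two_side {A B D E t B' d e z₀ z₁ : ℤ} (ht : t ≠ 0)
    (hA : (A : ZMod 3) ≠ 0) (hB : B = 3 * B') (hB' : (B' : ZMod 3) ≠ 0)
    (hD : D = 27 * t * d) (hE : E = 243 * t ^ 2 * e)
    (h₀ : (B' * z₀ ^ 2 + d * z₀ + e : ZMod 3) = 0) (h₀' : (2 * B' * z₀ + d : ZMod 3) ≠ 0)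
    (h₁ : (B' * z₁ ^ 2 + d * z₁ + e : ZMod 3) = 0) (h₁' : (2 * B' * z₁ + d : ZMod 3) ≠ 0)
    (h₀₁ : (z₀ : ZMod 3) ≠ z₁) :
    ∃ r : Fin 4 → ℤ_[3], Function.Injective r ∧
      ∀ i, r i ^ 4 + A * r i ^ 3 + B * r i ^ 2 + D * r i + E = 0 := by
  have h3 := three_eq_zero_zmod_three
  obtain ⟨u, hu, hur⟩ := exists_unit_root (A := A) (B := B) (D := D) (E := E) hA
    ⟨B', hB⟩
    ⟨9 * t * d, by rw [hD]; ring⟩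
    ⟨81 * t ^ 2 * e, by rw [hE]; ring⟩
  obtain ⟨v, hv, hvr⟩ : ∃ v : ℤ_[3], PadicInt.toZMod v ≠ 0 ∧
      (3 * v) ^ 4 + A * (3 * v) ^ 3 + B * (3 * v) ^ 2 + D * (3 * v) + E = 0 := by
    -- Modulo 3 this is $v^2(Av+B')$, and $1/A=A$ in $\mathbb{F}_3^\times$.
    obtain ⟨v, hv, h⟩ := PadicInt.exists_root_quartic (p := 3) 3 A B' (3 * (t * d))
      (3 * (3 * t ^ 2 * e)) (-B' * A)
      (by
        push_cast; rw [h3]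
        generalize (A : ZMod 3) = x at hA; generalize (B' : ZMod 3) = y at hB'
        simp only [zero_mul, zero_add, add_zero]
        revert x y; decide)
      (by
        push_cast; rw [h3]
        generalize (A : ZMod 3) = x at hA; generalize (B' : ZMod 3) = y at hB'
        simp only [zero_mul, add_zero]
        revert x y; decide)
    refine ⟨v, ?_, ?_⟩
    · rw [hv]; push_cast; exact mul_ne_zero (neg_ne_zero.2 hB') hA
    · rw [hB, hD, hE]
      push_cast at h ⊢
      linear_combination 27 * h
  have key : ∀ z : ℤ, (B' * z ^ 2 + d * z + e : ZMod 3) = 0 → (2 * B' * z + d : ZMod 3) ≠ 0 →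
      ∃ w : ℤ_[3], PadicInt.toZMod w = (z : ZMod 3) ∧
      ((9 * t : ℤ) * w) ^ 4 + A * ((9 * t : ℤ) * w) ^ 3 + B * ((9 * t : ℤ) * w) ^ 2 +
        D * ((9 * t : ℤ) * w) + E = 0 := by
    intro z hz hz'
    obtain ⟨w, hw, h⟩ := PadicInt.exists_root_quartic (p := 3) (3 * (9 * t ^ 2)) (3 * (A * t)) B' d e z
      (by push_cast; rw [h3]; simpa only [zero_mul, zero_add] using hz)
      (by push_cast; rw [h3]; simpa only [zero_mul, mul_zero, zero_add] using hz')
    refine ⟨w, hw, ?_⟩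
    rw [hB, hD, hE]
    push_cast at h ⊢
    linear_combination 243 * (t : ℤ_[3]) ^ 2 * h
  obtain ⟨w₀, hw₀, r0⟩ := key z₀ h₀ h₀'
  obtain ⟨w₁, hw₁, r1⟩ := key z₁ h₁ h₁'
  have h9t : ((9 * t : ℤ) : ℤ_[3]) ≠ 0 := by exact_mod_cast mul_ne_zero (by norm_num) ht
  have huv : ∀ z : ℤ_[3], u ≠ 3 * z := by
    rintro z rfl
    apply hu
    rw [map_mul, PadicInt.toZMod_three, zero_mul]
  have h9 : ∀ z : ℤ_[3], ((9 * t : ℤ) : ℤ_[3]) * z = 3 * (3 * (t * z)) := by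
    intro z; push_cast; ring
  have hvw : ∀ z : ℤ_[3], 3 * v ≠ (9 * t : ℤ) * z := by
    intro z h
    rw [h9] at h
    apply hv
    rw [mul_left_cancel₀ (OfNat.ofNat_ne_zero 3) h, map_mul, PadicInt.toZMod_three, zero_mul]
  have huw : ∀ z : ℤ_[3], u ≠ (9 * t : ℤ) * z := fun z => by rw [h9]; exact huv _
  have h01 : ((9 * t : ℤ) : ℤ_[3]) * w₀ ≠ (9 * t : ℤ) * w₁ := by
    intro h
    apply h₀₁
    rw [← hw₀, ← hw₁, mul_left_cancel₀ h9t h]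
  refine ⟨![u, 3 * v, (9 * t : ℤ) * w₀, (9 * t : ℤ) * w₁], ?_, ?_⟩
  · exact injective_vec_four (huv _) (huw _) (huw _) (hvw _) (hvw _) h01
  · intro i
    fin_cases i
    exacts [hur, hvr, r0, r1]

end Roots

/-! ### Roots of the quadrinomial under each condition. -/

section Quadrinomial

theorem exists_roots_of_shift {a b c s : ℤ}
    (h : ∃ r : Fin 4 → ℤ_[3], Function.Injective r ∧
      ∀ i, r i ^ 4 + ((a + 4 * s : ℤ) : ℤ_[3]) * r i ^ 3 +
        ((6 * s ^ 2 + 3 * a * s : ℤ) : ℤ_[3]) * r i ^ 2 +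
        ((4 * s ^ 3 + 3 * a * s ^ 2 + b : ℤ) : ℤ_[3]) * r i +
        ((s ^ 4 + a * s ^ 3 + b * s + c : ℤ) : ℤ_[3]) = 0) :
    ∃ r : Fin 4 → ℤ_[3], Function.Injective r ∧
      ∀ i, r i ^ 4 + a * r i ^ 3 + b * r i + c = 0 := by
  obtain ⟨r, hr, h⟩ := h
  refine ⟨fun i => r i + s, fun i j hij => hr (add_right_cancel hij), fun i => ?_⟩
  have := h i
  push_cast at this
  linear_combination this

theorem eq_pow_mul_pFree {p : ℕ} {m : ℤ} {n : ℕ} (h : nuVal p m = n) :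
    m = (p : ℤ) ^ n * pFree p m ∧ ¬ (p : ℤ) ∣ pFree p m := by
  have hp := emultiplicity_eq_coe.1 h
  have heq : m = (p : ℤ) ^ n * pFree p m := by
    rw [pFree, h, ENat.toNat_natCast, Int.mul_ediv_cancel' hp.1]
  refine ⟨heq, fun hd => hp.2 ?_⟩
  rw [pow_succ]
  conv_rhs => rw [heq]
  exact mul_dvd_mul_left _ hd

theorem pow_dvd_iff_le_nuVal {p n : ℕ} {m : ℤ} : (p : ℤ) ^ n ∣ m ↔ (n : ℕ∞) ≤ nuVal p m :=
  pow_dvd_iff_le_emultiplicity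

theorem exists_roots_of_even_valuation {a b c : ℤ} (ha : ¬ 3 ∣ a) (hb : 3 ∣ b)
    (hbc : 3 * nuVal 3 b < 2 * nuVal 3 c) (heven : Even (nuVal 3 b))
    (hres : pFree 3 b ≡ -a [ZMOD 3]) :
    ∃ r : Fin 4 → ℤ_[3], Function.Injective r ∧
      ∀ i, r i ^ 4 + a * r i ^ 3 + b * r i + c = 0 := by
  obtain ⟨n, hn⟩ : ∃ n : ℕ, nuVal 3 b = n := by
    refine ENat.ne_top_iff_exists.1 ?_ |>.imp fun _ => Eq.symm
    intro h
    simp [h] at hbc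
  have hn1 : 1 ≤ n := by
    have : ((1 : ℕ) : ℕ∞) ≤ nuVal 3 b := pow_dvd_iff_le_nuVal.1 (by simpa using hb)
    rw [hn] at this
    exact_mod_cast this
  obtain ⟨j, rfl⟩ : ∃ j, n = 2 * j + 2 := by
    obtain ⟨k, hk⟩ := heven
    rw [hn] at hk
    induction k using ENat.recTopCoe with
    | top => simp at hk
    | coe k =>
      have : n = k + k := by exact_mod_cast hk
      exact ⟨k - 1, by omega⟩
  obtain ⟨hb', -⟩ := eq_pow_mul_pFree hn
  -- The strict inequality $3(2j+2)<2\nu_3(c)$ forces $\nu_3(c)\ge 3j+4$.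
  obtain ⟨c', hc'⟩ : (3 : ℤ) ^ (3 * j + 4) ∣ c := by
    refine pow_dvd_iff_le_nuVal (p := 3).2 ?_
    rw [hn] at hbc
    generalize nuVal 3 c = v at hbc
    induction v using ENat.recTopCoe with
    | top => exact le_top
    | coe v =>
      norm_cast at hbc ⊢
      omega
  refine exists_roots_of_shift (s := 0) (exists_roots_of_one_two_side (t := 3 ^ j) (B' := 0)
    (d := pFree 3 b) (E' := c') (by positivity) ?_ (by ring) ?_ ?_ ?_)
  · rwa [mul_zero, add_zero, Ne, ZMod.intCast_zmod_eq_zero_iff_dvd]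
  · conv_lhs => rw [hb']
    push_cast; ring
  · rw [hc']; ring
  · rw [mul_zero, add_zero, ← Int.cast_neg]
    exact (ZMod.intCast_eq_intCast_iff _ _ 3).2 hres

/-- With $B'\equiv-1$ the residual quadratic is $w(d-w)$ with $d\ne0$ in the first alternative and
$1-w^2$ in the second; both have two simple roots. -/
theorem exists_roots_of_triple_root {A B' D E : ℤ} (hA : (A : ZMod 3) ≠ 0) (hB' : (B' : ZMod 3) = -1)
    (hD : (27 : ℤ) ∣ D) (hE : (243 : ℤ) ∣ E)
    (h : 2 * nuVal 3 D < nuVal 3 E + 1 ∨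
      (2 * nuVal 3 D > nuVal 3 E + 1 ∧ Odd (nuVal 3 E) ∧ pFree 3 E ≡ 1 [ZMOD 3])) :
    ∃ r : Fin 4 → ℤ_[3], Function.Injective r ∧
      ∀ i, r i ^ 4 + A * r i ^ 3 + ((3 * B' : ℤ) : ℤ_[3]) * r i ^ 2 + D * r i + E = 0 := by
  have hD3 : ((3 : ℕ) : ℕ∞) ≤ nuVal 3 D := pow_dvd_iff_le_nuVal.1 (by simpa using hD)
  have hE5 : ((5 : ℕ) : ℕ∞) ≤ nuVal 3 E := pow_dvd_iff_le_nuVal.1 (by simpa using hE)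
  have hB0 : (B' : ZMod 3) ≠ 0 := by rw [hB']; decide
  rcases h with h | ⟨h, hodd, hres⟩
  · obtain ⟨n, hn⟩ : ∃ n : ℕ, nuVal 3 D = n := by
      refine ENat.ne_top_iff_exists.1 ?_ |>.imp fun _ => Eq.symm
      intro h'
      simp [h'] at h
    rw [hn] at hD3 h
    obtain ⟨j, rfl⟩ : ∃ j, n = j + 3 :=
      ⟨n - 3, by have : 3 ≤ n := by exact_mod_cast hD3
                 omega⟩
    obtain ⟨hD', hd⟩ := eq_pow_mul_pFree hn
    obtain ⟨e, he⟩ : (3 : ℤ) ^ (2 * j + 6) ∣ E := by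
      refine pow_dvd_iff_le_nuVal (p := 3).2 ?_
      generalize nuVal 3 E = v at h
      induction v using ENat.recTopCoe with
      | top => exact le_top
      | coe v =>
        norm_cast at h ⊢
        omega
    have hd0 : ((pFree 3 D : ℤ) : ZMod 3) ≠ 0 := by rwa [Ne, ZMod.intCast_zmod_eq_zero_iff_dvd]
    refine exists_roots_of_one_one_two_side (t := 3 ^ j) (B' := B') (d := pFree 3 D) (e := 3 * e)
      (z₀ := 0) (z₁ := pFree 3 D) (by positivity) hA rfl hB0 ?_ ?_ ?_ ?_ ?_ ?_ ?_
    · conv_lhs => rw [hD']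
      push_cast; ring
    · rw [he]; ring
    · push_cast; rw [three_eq_zero_zmod_three]; ring
    · simpa using hd0
    · push_cast; rw [three_eq_zero_zmod_three, hB']; ring
    · rw [hB']
      intro h0
      exact hd0 (by linear_combination -h0)
    · simpa using hd0.symm
  · obtain ⟨m, hm⟩ : ∃ m : ℕ, nuVal 3 E = m := by
      refine ENat.ne_top_iff_exists.1 ?_ |>.imp fun _ => Eq.symm
      intro h'
      simp [h'] at h
    rw [hm] at hE5 h hodd
    obtain ⟨j, rfl⟩ : ∃ j, m = 2 * j + 5 := by
      obtain ⟨k, hk⟩ := hodd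
      have h5 : 5 ≤ m := by exact_mod_cast hE5
      induction k using ENat.recTopCoe with
      | top => simp at hk
      | coe k =>
        have : m = 2 * k + 1 := by exact_mod_cast hk
        exact ⟨k - 2, by omega⟩
    obtain ⟨hE', -⟩ := eq_pow_mul_pFree hm
    obtain ⟨d, hd⟩ : (3 : ℤ) ^ (j + 4) ∣ D := by
      refine pow_dvd_iff_le_nuVal (p := 3).2 ?_
      generalize nuVal 3 D = v at h
      induction v using ENat.recTopCoe with
      | top => exact le_top
      | coe v =>
        norm_cast at h ⊢
        omega
    have he : ((pFree 3 E : ℤ) : ZMod 3) = 1 := by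
      have := (ZMod.intCast_eq_intCast_iff _ _ 3).2 hres
      simpa using this
    refine exists_roots_of_one_one_two_side (t := 3 ^ j) (B' := B') (d := 3 * d) (e := pFree 3 E)
      (z₀ := 1) (z₁ := -1) (by positivity) hA rfl hB0 ?_ ?_ ?_ ?_ ?_ ?_ ?_
    · rw [hd]; ring
    · conv_lhs => rw [hE']
      push_cast; ring
    · push_cast; rw [three_eq_zero_zmod_three, hB', he, zero_mul]; decide
    · push_cast; rw [three_eq_zero_zmod_three, hB', zero_mul]; decide
    · push_cast; rw [three_eq_zero_zmod_three, hB', he, zero_mul]; decide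
    · push_cast; rw [three_eq_zero_zmod_three, hB', zero_mul]; decide
    · push_cast; decide

theorem exists_roots_near_neg_one {a b c : ℤ} (ha : 3 ∣ a) (hD : (27 : ℤ) ∣ -4 + 3 * a + b)
    (hE : (243 : ℤ) ∣ 1 - a - b + c)
    (h : 2 * nuVal 3 (-4 + 3 * a + b) < nuVal 3 (1 - a - b + c) + 1 ∨
      (2 * nuVal 3 (-4 + 3 * a + b) > nuVal 3 (1 - a - b + c) + 1 ∧
        Odd (nuVal 3 (1 - a - b + c)) ∧ pFree 3 (1 - a - b + c) ≡ 1 [ZMOD 3])) :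
    ∃ r : Fin 4 → ℤ_[3], Function.Injective r ∧
      ∀ i, r i ^ 4 + a * r i ^ 3 + b * r i + c = 0 := by
  have ha0 := (ZMod.intCast_zmod_eq_zero_iff_dvd a 3).2 ha
  have := exists_roots_of_triple_root (A := a - 4) (B' := 2 - a)
    (by push_cast; rw [ha0]; decide) (by push_cast; rw [ha0]; decide) hD hE h
  refine exists_roots_of_shift (s := -1) ?_
  convert this using 9 <;> push_cast <;> ring

theorem exists_roots_near_one {a b c : ℤ} (ha : 3 ∣ a) (hD : (27 : ℤ) ∣ 4 + 3 * a + b)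
    (hE : (243 : ℤ) ∣ 1 + a + b + c)
    (h : 2 * nuVal 3 (4 + 3 * a + b) < nuVal 3 (1 + a + b + c) + 1 ∨
      (2 * nuVal 3 (4 + 3 * a + b) > nuVal 3 (1 + a + b + c) + 1 ∧
        Odd (nuVal 3 (1 + a + b + c)) ∧ pFree 3 (1 + a + b + c) ≡ 1 [ZMOD 3])) :
    ∃ r : Fin 4 → ℤ_[3], Function.Injective r ∧
      ∀ i, r i ^ 4 + a * r i ^ 3 + b * r i + c = 0 := by
  have ha0 := (ZMod.intCast_zmod_eq_zero_iff_dvd a 3).2 ha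
  have := exists_roots_of_triple_root (A := a + 4) (B' := 2 + a)
    (by push_cast; rw [ha0]; decide) (by push_cast; rw [ha0]; decide) hD hE h
  refine exists_roots_of_shift (s := 1) ?_
  convert this using 9 <;> push_cast <;> ring

theorem exists_roots_of_two_side_near_neg_one {a b c : ℤ} (ha : a ≡ 2 [ZMOD 3])
    (hD : -4 + 3 * a + b ≡ 18 [ZMOD 27]) (hE : (81 : ℤ) ∣ 1 - a - b + c) :
    ∃ r : Fin 4 → ℤ_[3], Function.Injective r ∧
      ∀ i, r i ^ 4 + a * r i ^ 3 + b * r i + c = 0 := by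
  obtain ⟨e, he⟩ := hE
  obtain ⟨d, hd⟩ := hD.symm.dvd
  obtain ⟨a', ha'⟩ := ha.symm.dvd
  obtain rfl : a = 3 * a' + 2 := by linarith
  refine exists_roots_of_shift (s := -1) (exists_roots_of_one_two_side (t := 1)
    (B' := -a') (d := 3 * d + 2) (E' := e) one_ne_zero ?_ (by ring) ?_ ?_ ?_)
  · push_cast; rw [three_eq_zero_zmod_three, zero_mul]; decide
  · linear_combination hd
  · linear_combination he
  · push_cast; rw [three_eq_zero_zmod_three, zero_mul, zero_mul]; decide

end Quadrinomial

theorem mainTheorem2 (a b c : ℤ) (K : Type*) [Field K] [NumberField K] (α : K)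
    (hirr : Irreducible (quadrinomial a b c))
    (hroot : aeval α (quadrinomial a b c) = 0)
    (hgen : ℚ⟮α⟯ = ⊤)
    (μ ν ω τ : ℕ∞)
    (hμ : μ = nuVal 3 (1 - a - b + c)) (hν : ν = nuVal 3 (-4 + 3 * a + b))
    (hω : ω = nuVal 3 (1 + a + b + c)) (hτ : τ = nuVal 3 (4 + 3 * a + b))
    (hcond :
      ((a ≡ 1 [ZMOD 3] ∨ a ≡ -1 [ZMOD 3]) ∧ b ≡ 0 [ZMOD 3] ∧ c ≡ 0 [ZMOD 3] ∧
        3 * nuVal 3 b < 2 * nuVal 3 c ∧ Even (nuVal 3 b) ∧ pFree 3 b ≡ -a [ZMOD 3]) ∨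
      (PairMod 27 a b [(0, 4), (3, 22), (6, 13), (9, 4), (12, 22), (15, 13), (18, 4),
          (21, 22), (24, 13)] ∧
        a + b ≡ 1 + c [ZMOD 243] ∧
        (2 * ν < μ + 1 ∨
          (2 * ν > μ + 1 ∧ Odd μ ∧ pFree 3 (1 - a - b + c) ≡ 1 [ZMOD 3]))) ∨
      (PairMod 243 a b [(0, 23), (3, 14), (6, 5), (9, 23), (12, 14), (15, 5), (18, 23),
          (21, 14), (24, 5)] ∧
        a + b ≡ -(1 + c) [ZMOD 243] ∧
        (2 * τ < ω + 1 ∨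
          (2 * τ > ω + 1 ∧ Odd ω ∧ pFree 3 (1 + a + b + c) ≡ 1 [ZMOD 3]))) ∨
      (PairMod 27 a b [(2, 16), (5, 7), (8, 25), (11, 16), (14, 7), (17, 25), (20, 16),
          (23, 7), (26, 25)] ∧
        a + b ≡ c + 1 [ZMOD 81])) :
    SplitsIntoFour K 3 ∧ IsCommonIndexDivisor K 3 ∧ emultiplicity 3 (fieldIndex K) = 1 ∧
      ¬ IsMonogenicField K := by

  subst hμ hν hω hτ
  suffices h : ∃ r : Fin 4 → ℤ_[3], Function.Injective r ∧
      ∀ i, r i ^ 4 + a * r i ^ 3 + b * r i + c = 0 by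
    obtain ⟨r, hr, h⟩ := h
    exact splits_three_of_roots hirr hroot hgen hr h
  -- The lists encode, in order: $3\mid a$ with $27\mid-4+3a+b$; $3\mid a$ with $27\mid4+3a+b$ (read
  -- modulo 27); $a\equiv2$ modulo 3 with $-4+3a+b\equiv18$ modulo 27.
  simp only [PairMod, List.mem_cons, List.not_mem_nil, or_false, exists_eq_or_imp,
    exists_eq_left] at hcond
  rcases hcond with ⟨ha, hb, -, hbc, heven, hres⟩ | ⟨hab, hc, h⟩ | ⟨hab, hc, h⟩ | ⟨hab, hc⟩
  · simp only [Int.ModEq] at ha hb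
    exact exists_roots_of_even_valuation (by omega) (by omega) hbc heven hres
  · simp only [Int.ModEq] at hab hc
    exact exists_roots_near_neg_one (by omega) (by omega) (by omega) h
  · simp only [Int.ModEq] at hab hc
    exact exists_roots_near_one (by omega) (by omega) (by omega) h
  · simp only [Int.ModEq] at hab hc
    exact exists_roots_of_two_side_near_neg_one (by simp only [Int.ModEq]; omega)
      (by simp only [Int.ModEq]; omega) (by omega)
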